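/- Let $d$ be an even natural number and let $\mathbf F,\mathbf G$ be probability distributions on $\mathbb R^{d}$, with $\mathbf X=(X_1,\dots,X_d)\sim\mathbf F$ and $\mathbf Y=(Y_1,\dots,Y_d)\sim\mathbf G$. Let $\gamma:[0,\infty)\to[0,\infty)$ be continuous and increasing with $\gamma(0)=0$, differentiable on $(0,\infty)$ with a non-constant, completely monotone derivative there (that is, $\gamma'$ is smooth and $(-1)^m(\gamma')^{(m)}\ge 0$ on $(0,\infty)$ for all $m\ge 0$). For a two-element set $\{i,j\}\subseteq\{1,\dots,d\}$ put $\mathbf X_{\{i,j\}}=(X_i,X_j)$, $\mathbf Y_{\{i,j\}}=(Y_i,Y_j)$, with distributions $\mathbf F_{\{i,j\}}$, $\mathbf G_{\{i,j\}}$, and $$\mathcal E_{\{i,j\}}=2\,\mathrm E\,\gamma\big(\tfrac12\|\mathbf X_{1,\{i,j\}}-\mathbf Y_{1,\{i,j\}}\|^2\big)-\mathrm E\,\gamma\big(\tfrac12\|\mathbf X_{1,\{i,j\}}-\mathbf X_{2,\{i,j\}}\|^2\big)-\mathrm E\,\gamma\big(\tfrac12\|\mathbf Y_{1,\{i,j\}}-\mathbf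 Y_{2,\{i,j\}}\|^2\big),$$ where $\mathbf X_1,\mathbf X_2\sim\mathbf F$ and $\mathbf Y_1,\mathbf Y_2\sim\mathbf G$ are independent and $\|\cdot\|$ is the Euclidean norm; all these expectations are assumed to be finite. Let $\mathcal P$ be the set of perfect pairings, i.e. partitions of $\{1,\dots,d\}$ into two-element sets, and for $P\in\mathcal P$ let $\mathcal E(P)=\sum_{p\in P}\mathcal E_{p}$. Let $i_1,\dots,i_s,j_1,\dots,j_s$ be distinct elements of $\{1,\dots,d\}$ (with $s\ge 0$), let $S=\{\{i_1,j_1\},\dots,\{i_s,j_s\}\}$ be the set of signal pairs and $N=\{1,\dots,d\}\setminus\{i_1,\dots,i_s,j_1,\dots,j_s\}$ the set of noise coordinates. Assume that 1. $X_k$ and $Y_k$ have the same distribution for every $1\le k\le d$; 2. $\mathbf F_p\neq\mathbf G_p$ for every $p\in S$, and $\mathbf F_{\{l,l'\}}=\mathbf G_{\{l,l'\}}$ for all distinct $l,l'\in N$; 3. for all distinct $p,q\in S$, $\mathbf X_p$ and $\mathbf X_q$ are independent, and $\mathbf Y_p$ and $\mathbf Y_q$ are independent; 4. for all $p\in S$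 and $l\in N$, $\mathbf X_p$ and $X_l$ are independent, and $\mathbf Y_p$ and $Y_l$ are independent. Then $$\max_{P\in\mathcal P}\mathcal E(P)=\sum_{p\in S}\mathcal E_p=\sum_{k=1}^{s}\mathcal E_{\{i_k,j_k\}},$$ and a perfect pairing $P\in\mathcal P$ attains the maximum if and only if $S\subseteq P$. -/

import Mathlib

open MeasureTheory ProbabilityTheory
open scoped ContDiff

noncomputable section

/-- `f` is completely monotone on the open half-line `(0, ∞)`: it is smooth there and
`(-1)ⁿ f⁽ⁿ⁾ ≥ 0` for every `n`. -/
def CompletelyMonotone (f : ℝ → ℝ) : Prop :=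
  ContDiffOn ℝ ∞ f (Set.Ioi 0) ∧
    ∀ (n : ℕ) (t : ℝ), 0 < t → 0 ≤ (-1 : ℝ) ^ n * iteratedDeriv n f t

/-- The functions `γ : [0, ∞) → [0, ∞)` that generate energy distances: continuous, increasing,
zero at zero, with a non-constant completely monotone derivative on `(0, ∞)`.
(Only the values of `γ` on `[0, ∞)` are ever used; nonnegativity follows from
monotonicity and `γ 0 = 0`.) -/
structure IsEnergyGenerator (γ : ℝ → ℝ) : Prop where
  continuousOn : ContinuousOn γ (Set.Ici 0)
  monotoneOn : MonotoneOn γ (Set.Ici 0)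
  map_zero : γ 0 = 0
  differentiableOn : DifferentiableOn ℝ γ (Set.Ioi 0)
  completelyMonotone_deriv : CompletelyMonotone (deriv γ)
  deriv_nonconstant : ¬ ∃ c : ℝ, ∀ t : ℝ, 0 < t → deriv γ t = c

section Energy

variable {E : Type*} [NormedAddCommGroup E] [MeasurableSpace E]

/-- `E[γ(‖U - V‖² / 2)]` for independent `U ∼ μ` and `V ∼ ν`. -/
def meanGap (γ : ℝ → ℝ) (μ ν : Measure E) : ℝ :=
  ∫ p : E × E, γ (‖p.1 - p.2‖ ^ 2 / 2) ∂(μ.prod ν)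

/-- The expectation `E[γ(‖U - V‖² / 2)]` for independent `U ∼ μ` and `V ∼ ν` is finite. -/
def MeanGapFinite (γ : ℝ → ℝ) (μ ν : Measure E) : Prop :=
  Integrable (fun p : E × E => γ (‖p.1 - p.2‖ ^ 2 / 2)) (μ.prod ν)

/-- The energy distance `2 E[γ(‖X₁ - Y₁‖²/2)] - E[γ(‖X₁ - X₂‖²/2)] - E[γ(‖Y₁ - Y₂‖²/2)]`, where
`X₁, X₂ ∼ μ` and `Y₁, Y₂ ∼ ν` are independent. -/
def energyDist (γ : ℝ → ℝ) (μ ν : Measure E) : ℝ :=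
  2 * meanGap γ μ ν - meanGap γ μ μ - meanGap γ ν ν

/-- All three expectations in the energy distance are finite. -/
def EnergyFinite (γ : ℝ → ℝ) (μ ν : Measure E) : Prop :=
  MeanGapFinite γ μ ν ∧ MeanGapFinite γ μ μ ∧ MeanGapFinite γ ν ν

end Energy

section Pairs

variable {d : ℕ}

/-- The subvector `x_p = (x_k)_{k ∈ p}` of `x ∈ ℝᵈ`, an element of the Euclidean space `ℝᵖ`. -/
def subvector (p : Finset (Fin d)) (x : Fin d → ℝ) : EuclideanSpace ℝ p :=
  WithLp.toLp 2 fun k => x k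

/-- The joint distribution of the coordinates in `p` of a random vector with distribution `F`. -/
def jointLaw (F : Measure (Fin d → ℝ)) (p : Finset (Fin d)) : Measure (EuclideanSpace ℝ p) :=
  F.map (subvector p)

/-- The distribution of the `k`-th coordinate of a random vector with distribution `F`. -/
def marginalLaw (F : Measure (Fin d → ℝ)) (k : Fin d) : Measure ℝ :=
  F.map fun x => x k

/-- The energy distance between the joint distributions of the coordinates in the pair `p`. -/
def pairEnergy (γ : ℝ → ℝ) (F G : Measure (Fin d → ℝ)) (p : Finset (Fin d)) : ℝ :=
  energyDist γ (jointLaw F p) (jointLaw G p)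

/-- A perfect pairing: a partition of the set of all coordinates into two-element blocks. -/
def PerfectPairing (d : ℕ) : Type :=
  {P : Finpartition (Finset.univ : Finset (Fin d)) // ∀ p ∈ P.parts, p.card = 2}

/-- The set of pairs of a perfect pairing. -/
def PerfectPairing.pairs (P : PerfectPairing d) : Finset (Finset (Fin d)) :=
  P.1.parts

/-- The total pair energy of a perfect pairing. -/
def totalEnergy (γ : ℝ → ℝ) (F G : Measure (Fin d → ℝ)) (P : PerfectPairing d) : ℝ :=
  ∑ p ∈ P.pairs, pairEnergy γ F G p

/-- The set of pairs `{i₁, j₁}, …, {iₛ, jₛ}`. -/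
def signalPairs {s : ℕ} (i j : Fin s → Fin d) : Finset (Finset (Fin d)) :=
  Finset.univ.image fun k => {i k, j k}

/-- The coordinates outside `{i₁, …, iₛ, j₁, …, jₛ}`. -/
def noiseCoords {s : ℕ} (i j : Fin s → Fin d) : Set (Fin d) :=
  (Set.range i ∪ Set.range j)ᶜ

/-- Under `H`, the subvectors of any two different signal pairs are independent, and the
subvector of any signal pair is independent of any noise coordinate. -/
structure SignalIndependence {s : ℕ} (i j : Fin s → Fin d) (H : Measure (Fin d → ℝ)) :
    Prop where
  signal_signal : ∀ p ∈ signalPairs i j, ∀ q ∈ signalPairs i j, p ≠ q →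
    IndepFun (subvector p) (subvector q) H
  signal_noise : ∀ p ∈ signalPairs i j, ∀ l ∈ noiseCoords i j,
    IndepFun (subvector p) (fun x => x l) H

/-- The paired-signal setting: the indices `i₁, …, iₛ, j₁, …, jₛ` are distinct, all marginals
of `F` and `G` agree, the joint distributions of every signal pair differ, and the joint
distributions of any two noise coordinates agree. -/
structure PairedSignalSetting {s : ℕ} (i j : Fin s → Fin d) (F G : Measure (Fin d → ℝ)) :
    Prop where
  distinct : Function.Injective (Sum.elim i j)
  marginal_eq : ∀ k, marginalLaw F k = marginalLaw G k
  signal_ne : ∀ p ∈ signalPairs i j, jointLaw F p ≠ jointLaw G p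
  noise_eq : ∀ l ∈ noiseCoords i j, ∀ l' ∈ noiseCoords i j, l ≠ l' →
    jointLaw F {l, l'} = jointLaw G {l, l'}

end Pairs

end

/-! ### Gaussian kernels and characteristic functions -/

section GaussianKernel

/-! The combinatorial side is short. Two coordinates that do not form a signal pair either are both
noise, with equal joint laws by assumption, or are independent under both `F` and `G`, and then the
equal marginals force equal joint laws. Such pairs have energy zero, so the total energy of a
pairing is the sum over the signal pairs it contains. Once signal energies are known to be positive,
the maximum is the full signal sum, attained exactly by the pairings containing `S`; one exists
because evenly many coordinates remain.

The analytic core is `IsEnergyGenerator.energyDist_pos`: different laws have positive energy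
distance. For `exp (-(l * t))` with `l > 0`, Fourier inversion of the Gaussian writes the energy
distance as minus a weighted `L²` distance of characteristic functions, hence negative. A completely
monotone function continuous at 0 is a limit of nonnegative combinations of such exponentials (a
discrete form of Bernstein's theorem, via Hausdorff moments). Its energy distance is therefore
nonpositive, and a compactness bound keeps it strictly negative unless the function is constant.
Finally, `γ` is a shifted copy of itself, minus two completely monotone increments, plus a constant.
As the shift grows the copy tends to a linear function, whose energy distance is nonnegative, while
one fixed increment contributes a strictly positive amount. -/

theorem continuous_charFun_of_isFiniteMeasure {E : Type*} [NormedAddCommGroup E]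
    [InnerProductSpace ℝ E] [SecondCountableTopology E] [MeasurableSpace E] [BorelSpace E] (μ : Measure E) [IsFiniteMeasure μ] :
    Continuous (charFun μ) := by
  unfold charFun
  refine continuous_of_dominated (bound := fun _ => 1) (fun v => ?_) (fun v => ?_)
    (integrable_const _) (ae_of_all _ fun x => by fun_prop)
  · exact Continuous.aestronglyMeasurable (by fun_prop)
  · exact ae_of_all _ fun x => by simp [Complex.norm_exp]

open scoped ComplexConjugate

variable {E : Type*} [NormedAddCommGroup E] [InnerProductSpace ℝ E] [FiniteDimensional ℝ E]
  [MeasurableSpace E] [BorelSpace E]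

/-- A Gaussian is the Fourier transform of a Gaussian; `C` is the inverse of the total mass of the
one with parameter `1 / (2 * l)`. -/
theorem exp_neg_mul_sq_norm_eq_integral {l : ℝ} (hl : 0 < l) :
    ∃ C : ℝ, 0 < C ∧ ∀ z : E, (Real.exp (-(l * (‖z‖ ^ 2 / 2))) : ℂ) =
      C * ∫ v : E, Complex.exp (-((1 / (2 * l) : ℝ) : ℂ) * ‖v‖ ^ 2
        + Complex.I * (inner ℝ z v : ℝ)) := by
  have hb : 0 < ((1 / (2 * l) : ℝ) : ℂ).re := by
    rw [Complex.ofReal_re]; positivity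
  have hpos : (0 : ℝ) < (Real.pi / (1 / (2 * l))) ^ (Module.finrank ℝ E / 2 : ℝ) := by positivity
  refine ⟨((Real.pi / (1 / (2 * l))) ^ (Module.finrank ℝ E / 2 : ℝ))⁻¹, by positivity, fun z => ?_⟩
  rw [GaussianFourier.integral_cexp_neg_mul_sq_norm_add hb]
  have h1 : ((Real.pi : ℂ) / ((1 / (2 * l) : ℝ) : ℂ)) ^ (Module.finrank ℝ E / 2 : ℂ)
      = (((Real.pi / (1 / (2 * l))) ^ (Module.finrank ℝ E / 2 : ℝ) : ℝ) : ℂ) := by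
    rw [Complex.ofReal_cpow (by positivity)]
    push_cast
    rfl
  rw [h1, Complex.ofReal_inv, inv_mul_cancel_left₀ (by exact_mod_cast hpos.ne'),
    Complex.ofReal_exp]
  congr 1
  have : (l : ℂ) ≠ 0 := by exact_mod_cast hl.ne'
  push_cast
  rw [Complex.I_sq]
  field_simp
  ring

/-- After Fubini, the character at `x - y` factors into the two characteristic functions. `C` is
chosen before the measures, so the three terms of an energy distance share it. -/
theorem meanGap_exp_eq_integral {l : ℝ} (hl : 0 < l) :
    ∃ C : ℝ, 0 < C ∧ ∀ μ ν : Measure E, IsFiniteMeasure μ → IsFiniteMeasure ν →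
      meanGap (fun t => Real.exp (-(l * t))) μ ν =
        C * ∫ v : E, Real.exp (-(1 / (2 * l)) * ‖v‖ ^ 2) *
          (charFun μ v * conj (charFun ν v)).re := by
  obtain ⟨C, hC, h⟩ := exp_neg_mul_sq_norm_eq_integral (E := E) hl
  refine ⟨C, hC, fun μ ν _ _ => ?_⟩
  set b : ℝ := 1 / (2 * l) with hb
  have hbpos : 0 < b := by positivity
  have hgauss : Integrable (fun v : E => Real.exp (-b * ‖v‖ ^ 2)) := by
    have := (GaussianFourier.integrable_cexp_neg_mul_sq_norm_add (V := E) (b := (b : ℂ))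
      (by simpa using hbpos) 0 0).norm
    refine this.congr (ae_of_all _ fun v => ?_)
    simp [Complex.norm_exp, ← Complex.ofReal_pow]
  have hint : Integrable (Function.uncurry fun (p : E × E) (v : E) =>
      Complex.exp (-(b : ℂ) * ‖v‖ ^ 2 + Complex.I * (inner ℝ (p.1 - p.2) v : ℝ)))
      ((μ.prod ν).prod volume) := by
    refine ((integrable_const (1 : ℝ)).mul_prod hgauss).mono' ?_ (ae_of_all _ fun p => ?_)
    · exact Continuous.aestronglyMeasurable (by unfold Function.uncurry; fun_prop)
    · simp [Function.uncurry, Complex.norm_exp, ← Complex.ofReal_pow]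
  have key : ((meanGap (fun t => Real.exp (-(l * t))) μ ν : ℝ) : ℂ) =
      C * ∫ v : E, (Real.exp (-b * ‖v‖ ^ 2) : ℂ) * (charFun μ v * conj (charFun ν v)) := by
    rw [meanGap, ← integral_complex_ofReal]
    simp_rw [h]
    rw [integral_const_mul, integral_integral_swap hint]
    congr 1
    refine integral_congr_ae (ae_of_all _ fun v => ?_)
    simp only
    rw [← charFun_neg, charFun_apply, charFun_apply, ← integral_prod_mul, ← integral_const_mul]
    refine integral_congr_ae (ae_of_all _ fun p => ?_)
    simp only
    rw [← Complex.exp_add, Complex.ofReal_exp, ← Complex.exp_add]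
    congr 1
    rw [inner_sub_left, inner_neg_right]
    push_cast
    ring
  have hint2 : Integrable (fun v : E =>
      (Real.exp (-b * ‖v‖ ^ 2) : ℂ) * (charFun μ v * conj (charFun ν v))) := by
    refine (hgauss.mul_const (μ.real Set.univ * ν.real Set.univ)).mono' ?_ (ae_of_all _ fun v => ?_)
    · refine AEStronglyMeasurable.mul (Continuous.aestronglyMeasurable (by fun_prop)) ?_
      exact (measurable_charFun.mul
        (Complex.continuous_conj.measurable.comp measurable_charFun)).aestronglyMeasurable
    · rw [norm_mul, norm_mul, RCLike.norm_conj, Complex.norm_real, Real.norm_eq_abs, Real.abs_exp]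
      gcongr <;> exact norm_charFun_le _
  have h2 := congrArg Complex.re key
  rw [Complex.ofReal_re, Complex.re_ofReal_mul] at h2
  rw [h2]
  congr 1
  have h3 := integral_re hint2
  simp only [RCLike.re_to_complex] at h3
  rw [← h3]
  simp only [Complex.re_ofReal_mul]

theorem energyDist_exp_eq_neg_integral {l : ℝ} (hl : 0 < l) (μ ν : Measure E)
    [IsFiniteMeasure μ] [IsFiniteMeasure ν] :
    ∃ C : ℝ, 0 < C ∧ Integrable (fun v : E => Real.exp (-(1 / (2 * l)) * ‖v‖ ^ 2) *
        ‖charFun μ v - charFun ν v‖ ^ 2) ∧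
      energyDist (fun t => Real.exp (-(l * t))) μ ν =
        -(C * ∫ v : E, Real.exp (-(1 / (2 * l)) * ‖v‖ ^ 2) *
          ‖charFun μ v - charFun ν v‖ ^ 2) := by
  obtain ⟨C, hC, h⟩ := meanGap_exp_eq_integral (E := E) hl
  have hgauss : Integrable (fun v : E => Real.exp (-(1 / (2 * l)) * ‖v‖ ^ 2)) := by
    have := (GaussianFourier.integrable_cexp_neg_mul_sq_norm_add (V := E)
      (b := ((1 / (2 * l) : ℝ) : ℂ)) (by rw [Complex.ofReal_re]; positivity) 0 0).norm
    refine this.congr (ae_of_all _ fun v => ?_)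
    simp [Complex.norm_exp, ← Complex.ofReal_pow, -Complex.inv_re,
      ← Complex.ofReal_mul, ← Complex.ofReal_neg]
  have hint : ∀ μ ν : Measure E, IsFiniteMeasure μ → IsFiniteMeasure ν →
      Integrable (fun v : E => Real.exp (-(1 / (2 * l)) * ‖v‖ ^ 2) *
          (charFun μ v * conj (charFun ν v)).re) := by
    intro μ ν _ _
    refine (hgauss.mul_const (μ.real Set.univ * ν.real Set.univ)).mono' ?_ (ae_of_all _ fun v => ?_)
    · refine AEStronglyMeasurable.mul (Continuous.aestronglyMeasurable (by fun_prop)) ?_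
      exact (Complex.measurable_re.comp (measurable_charFun.mul
        (Complex.continuous_conj.measurable.comp measurable_charFun))).aestronglyMeasurable
    · rw [norm_mul, Real.norm_eq_abs, Real.abs_exp]
      gcongr
      refine (Complex.abs_re_le_norm _).trans ?_
      rw [norm_mul, RCLike.norm_conj]
      gcongr <;> exact norm_charFun_le _
  have heq : ∀ v : E, Real.exp (-(1 / (2 * l)) * ‖v‖ ^ 2) * ‖charFun μ v - charFun ν v‖ ^ 2 =
      Real.exp (-(1 / (2 * l)) * ‖v‖ ^ 2) * (charFun μ v * conj (charFun μ v)).re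
      + Real.exp (-(1 / (2 * l)) * ‖v‖ ^ 2) * (charFun ν v * conj (charFun ν v)).re
      - 2 * (Real.exp (-(1 / (2 * l)) * ‖v‖ ^ 2) * (charFun μ v * conj (charFun ν v)).re) := by
    intro v
    rw [← Complex.normSq_eq_norm_sq, Complex.normSq_apply]
    simp only [Complex.mul_re, Complex.conj_re, Complex.conj_im, Complex.sub_re, Complex.sub_im]
    ring
  have i1 := hint μ μ inferInstance inferInstance
  have i2 := hint ν ν inferInstance inferInstance
  have i3 := hint μ ν inferInstance inferInstance
  simp_rw [heq]
  refine ⟨C, hC, (i1.add i2).sub (i3.const_mul 2), ?_⟩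
  have i12 : Integrable (fun v : E =>
      Real.exp (-(1 / (2 * l)) * ‖v‖ ^ 2) * (charFun μ v * conj (charFun μ v)).re
      + Real.exp (-(1 / (2 * l)) * ‖v‖ ^ 2) * (charFun ν v * conj (charFun ν v)).re) := i1.add i2
  rw [integral_sub i12 (i3.const_mul 2), integral_add i1 i2, integral_const_mul,
    energyDist, h μ ν inferInstance inferInstance, h μ μ inferInstance inferInstance,
    h ν ν inferInstance inferInstance]
  ring

theorem energyDist_exp_nonpos {l : ℝ} (hl : 0 < l) (μ ν : Measure E)
    [IsFiniteMeasure μ] [IsFiniteMeasure ν] :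
    energyDist (fun t => Real.exp (-(l * t))) μ ν ≤ 0 := by
  obtain ⟨C, hC, -, h⟩ := energyDist_exp_eq_neg_integral hl μ ν
  rw [h, neg_nonpos]
  exact mul_nonneg hC.le (integral_nonneg fun v => by positivity)

/-- The Fourier integrand is continuous and nonnegative; were it identically zero, the
characteristic functions, hence the measures, would coincide. -/
theorem energyDist_exp_neg {l : ℝ} (hl : 0 < l) {μ ν : Measure E}
    [IsFiniteMeasure μ] [IsFiniteMeasure ν] (hne : μ ≠ ν) :
    energyDist (fun t => Real.exp (-(l * t))) μ ν < 0 := by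
  obtain ⟨C, hC, hi, h⟩ := energyDist_exp_eq_neg_integral hl μ ν
  rw [h, neg_lt_zero]
  refine mul_pos hC ?_
  have hcont : Continuous fun v : E => Real.exp (-(1 / (2 * l)) * ‖v‖ ^ 2) *
        ‖charFun μ v - charFun ν v‖ ^ 2 := by
    have := continuous_charFun_of_isFiniteMeasure μ
    have := continuous_charFun_of_isFiniteMeasure ν
    fun_prop
  rw [integral_pos_iff_support_of_nonneg (fun v => by positivity) hi]
  refine hcont.isOpen_support.measure_pos _ ?_
  by_contra hemp
  rw [Set.not_nonempty_iff_eq_empty, Function.support_eq_empty_iff] at hemp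
  refine hne (Measure.ext_of_charFun (funext fun v => ?_))
  have := congrFun hemp v
  simpa [sub_eq_zero] using this

end GaussianKernel

/-! ### Completely monotone functions as limits of exponential sums -/

section CompletelyMonotone

open Filter Topology Polynomial

theorem CompletelyMonotone.nonneg {f : ℝ → ℝ} (hf : CompletelyMonotone f) {t : ℝ} (ht : 0 < t) :
    0 ≤ f t := by
  simpa using hf.2 0 t ht

theorem CompletelyMonotone.contDiffAt {f : ℝ → ℝ} (hf : CompletelyMonotone f) {t : ℝ}
    (ht : 0 < t) : ContDiffAt ℝ ∞ f t :=
  hf.1.contDiffAt (Ioi_mem_nhds ht)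

theorem CompletelyMonotone.congr {f g : ℝ → ℝ} (hf : CompletelyMonotone f)
    (h : Set.EqOn g f (Set.Ioi 0)) : CompletelyMonotone g := by
  refine ⟨hf.1.congr h, fun n t ht => ?_⟩
  rw [h.iteratedDeriv_of_isOpen isOpen_Ioi n ht]
  exact hf.2 n t ht

theorem CompletelyMonotone.contDiffOn_iteratedDeriv {f : ℝ → ℝ} (hf : CompletelyMonotone f)
    (n : ℕ) : ContDiffOn ℝ ∞ (iteratedDeriv n f) (Set.Ioi 0) := by
  induction n with
  | zero => simpa using hf.1
  | succ n ih =>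
    rw [iteratedDeriv_succ]
    exact ((contDiffOn_infty_iff_deriv_of_isOpen isOpen_Ioi).mp ih).2

theorem CompletelyMonotone.antitoneOn_iteratedDeriv {f : ℝ → ℝ} (hf : CompletelyMonotone f)
    (n : ℕ) : AntitoneOn (fun t => (-1 : ℝ) ^ n * iteratedDeriv n f t) (Set.Ioi 0) := by
  have hd : DifferentiableOn ℝ (fun t => (-1 : ℝ) ^ n * iteratedDeriv n f t) (Set.Ioi 0) :=
    ((hf.contDiffOn_iteratedDeriv n).differentiableOn (by simp)).const_mul _
  refine antitoneOn_of_deriv_nonpos (convex_Ioi 0) hd.continuousOn ?_ fun t ht => ?_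
  · rwa [interior_Ioi]
  · rw [interior_Ioi] at ht
    rw [deriv_const_mul_field, ← iteratedDeriv_succ]
    have := hf.2 (n + 1) t ht
    rw [pow_succ] at this
    linarith

theorem CompletelyMonotone.antitoneOn {f : ℝ → ℝ} (hf : CompletelyMonotone f) :
    AntitoneOn f (Set.Ioi 0) := by
  simpa using hf.antitoneOn_iteratedDeriv 0

theorem CompletelyMonotone.antitoneOn_Ici {f : ℝ → ℝ} (hf : CompletelyMonotone f)
    (hc : ContinuousOn f (Set.Ici 0)) : AntitoneOn f (Set.Ici 0) := by
  refine antitoneOn_of_deriv_nonpos (convex_Ici 0) hc ?_ fun t ht => ?_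
  · rw [interior_Ici]
    exact hf.1.differentiableOn (by simp)
  · rw [interior_Ici] at ht
    have := hf.2 1 t ht
    rw [iteratedDeriv_one] at this
    linarith

theorem CompletelyMonotone.nonneg_of_continuousOn {f : ℝ → ℝ} (hf : CompletelyMonotone f)
    (hc : ContinuousOn f (Set.Ici 0)) {t : ℝ} (ht : 0 ≤ t) : 0 ≤ f t :=
  (hf.nonneg (by linarith : 0 < t + 1)).trans
    (hf.antitoneOn_Ici hc ht (Set.mem_Ici.mpr (by linarith)) (by linarith))

theorem CompletelyMonotone.comp_add {f : ℝ → ℝ} (hf : CompletelyMonotone f) {h : ℝ}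
    (hh : 0 ≤ h) : CompletelyMonotone (fun t => f (t + h)) := by
  refine ⟨hf.1.comp (by fun_prop) fun t ht => ?_, fun n t ht => ?_⟩
  · exact lt_of_lt_of_le (Set.mem_Ioi.mp ht) (by linarith)
  · rw [iteratedDeriv_comp_add_const]
    exact hf.2 n _ (by linarith)

/-- Each signed derivative is antitone, so its backward difference is nonnegative. This closure
property drives the Hausdorff moment induction. -/
theorem CompletelyMonotone.sub_comp_add {f : ℝ → ℝ} (hf : CompletelyMonotone f) {h : ℝ}
    (hh : 0 ≤ h) : CompletelyMonotone (fun t => f t - f (t + h)) := by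
  have hs := hf.comp_add hh
  refine ⟨hf.1.sub hs.1, fun n t ht => ?_⟩
  have : iteratedDeriv n (fun t => f t - f (t + h)) t =
      iteratedDeriv n f t - iteratedDeriv n f (t + h) := by
    have := iteratedDeriv_sub (n := n) (x := t) ((hf.contDiffAt ht).of_le (by exact_mod_cast le_top))
      ((hs.contDiffAt ht).of_le (by exact_mod_cast le_top))
    rw [iteratedDeriv_comp_add_const] at this
    exact this
  rw [this, mul_sub, sub_nonneg]
  exact hf.antitoneOn_iteratedDeriv n (Set.mem_Ioi.mpr ht) (Set.mem_Ioi.mpr (by linarith))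
    (by linarith)

theorem CompletelyMonotone.of_neg_deriv {g : ℝ → ℝ} (hd : DifferentiableOn ℝ g (Set.Ioi 0))
    (h0 : ∀ t, 0 < t → 0 ≤ g t) (h : CompletelyMonotone (fun t => -deriv g t)) :
    CompletelyMonotone g := by
  refine ⟨?_, fun n t ht => ?_⟩
  · rw [contDiffOn_infty_iff_deriv_of_isOpen isOpen_Ioi]
    refine ⟨hd, ?_⟩
    simpa using h.1.neg
  · cases n with
    | zero => simpa using h0 t ht
    | succ n =>
      have := h.2 n t ht
      rw [iteratedDeriv_fun_neg] at this
      rw [iteratedDeriv_succ', pow_succ]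
      linarith

/-- The linear functional on polynomials with moments `a`. -/
noncomputable def momentFunctional (a : ℕ → ℝ) : ℝ[X] →ₗ[ℝ] ℝ :=
  Polynomial.lsum fun j => LinearMap.mulRight ℝ (a j)

theorem momentFunctional_monomial (a : ℕ → ℝ) (j : ℕ) (c : ℝ) :
    momentFunctional a (monomial j c) = c * a j := by
  simp [momentFunctional, Polynomial.lsum_apply]

theorem momentFunctional_X_pow (a : ℕ → ℝ) (j : ℕ) : momentFunctional a (X ^ j) = a j := by
  rw [X_pow_eq_monomial, momentFunctional_monomial, one_mul]

theorem momentFunctional_mul_one_sub_X (a : ℕ → ℝ) (p : ℝ[X]) :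
    momentFunctional a (p * (1 - X)) = momentFunctional (fun j => a j - a (j + 1)) p := by
  induction p using Polynomial.induction_on' with
  | add p q hp hq => rw [add_mul, map_add, map_add, hp, hq]
  | monomial j c =>
    rw [mul_sub, mul_one, map_sub, monomial_mul_X]
    simp only [momentFunctional_monomial]
    ring

/-- Each factor `1 - X` differences the moments, which replaces `f` by `f t - f (t + h)`, again
completely monotone. -/
theorem momentFunctional_nonneg {f : ℝ → ℝ} (hf : CompletelyMonotone f)
    (hc : ContinuousOn f (Set.Ici 0)) {h : ℝ} (hh : 0 ≤ h) (k m : ℕ) :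
    0 ≤ momentFunctional (fun j => f (j * h)) (X ^ k * (1 - X) ^ m) := by
  induction m generalizing f with
  | zero =>
    rw [pow_zero, mul_one, momentFunctional_X_pow]
    exact hf.nonneg_of_continuousOn hc (by positivity)
  | succ m ih =>
    rw [pow_succ, ← mul_assoc, momentFunctional_mul_one_sub_X]
    have := ih (hf.sub_comp_add hh) (hc.sub (hc.comp (by fun_prop) fun t ht =>
      add_nonneg (Set.mem_Ici.mp ht) hh))
    convert this using 6
    push_cast; ring

/-- Expand `X ^ j * (X + (1 - X)) ^ (N - j)` by the binomial theorem; the coefficients vanish for `k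
< j`. -/
theorem X_pow_eq_sum_bernsteinPolynomial {N j : ℕ} (hj : j ≤ N) :
    (X : ℝ[X]) ^ j = ∑ k ∈ Finset.range (N + 1),
      ((k.descFactorial j : ℝ) / N.descFactorial j) • bernsteinPolynomial ℝ N k := by
  have h1 : (X : ℝ[X]) ^ j = X ^ j * (X + (1 - X)) ^ (N - j) := by simp
  have h2 : N + 1 = j + (N - j + 1) := by omega
  have h3 : ∑ k ∈ Finset.range j,
      ((k.descFactorial j : ℝ) / N.descFactorial j) • bernsteinPolynomial ℝ N k = 0 := by
    refine Finset.sum_eq_zero fun k hk => ?_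
    rw [Nat.descFactorial_of_lt (Finset.mem_range.mp hk)]
    simp
  rw [h2, Finset.sum_range_add, h3, h1, add_pow, zero_add, Finset.mul_sum]
  refine Finset.sum_congr rfl fun m hm => ?_
  have hm' : m ≤ N - j := by simpa [Nat.lt_succ_iff] using hm
  have hch : (N.choose (j + m) : ℝ) * (j + m).choose j = N.choose j * (N - j).choose m := by
    have := Nat.choose_mul (n := N) (k := j + m) (s := j) (by omega)
    rw [Nat.add_sub_cancel_left] at this
    exact_mod_cast this
  have hpos : (N.choose j : ℝ) ≠ 0 := by exact_mod_cast (Nat.choose_pos hj).ne'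
  have hfac : (j.factorial : ℝ) ≠ 0 := by exact_mod_cast j.factorial_ne_zero
  have hco : (((j + m).descFactorial j : ℝ) / N.descFactorial j) * N.choose (j + m)
      = (N - j).choose m := by
    rw [Nat.descFactorial_eq_factorial_mul_choose, Nat.descFactorial_eq_factorial_mul_choose]
    push_cast
    rw [mul_div_mul_left _ _ hfac, div_mul_eq_mul_div, mul_comm ((j + m).choose j : ℝ), hch,
      mul_div_cancel_left₀ _ hpos]
  rw [bernsteinPolynomial, smul_eq_C_mul, ← Nat.sub_sub, ← map_natCast (C : ℝ →+* ℝ[X]),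
    ← map_natCast (C : ℝ →+* ℝ[X]), ← hco, C_mul]
  ring

/-- The quotient is a product of factors `(k - i) / (N - i)`, each within `(i + 1) / (N + 1)` of the
node; as all factors lie in `[0, 1]`, the errors add up. -/
theorem abs_descFactorial_div_sub_pow_le {N k j : ℕ} (hk : k ≤ N) (hj : j ≤ N) :
    |(k.descFactorial j : ℝ) / N.descFactorial j - (((k : ℝ) + 1) / (N + 1)) ^ j|
      ≤ (j : ℝ) ^ 2 / (N + 1) := by
  induction j with
  | zero => simp
  | succ j ih =>
    have ih := ih (by omega)
    set x : ℝ := ((k : ℝ) + 1) / (N + 1)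
    set r : ℝ := (k.descFactorial j : ℝ) / N.descFactorial j
    have hkN : (k : ℝ) ≤ N := by exact_mod_cast hk
    have hjN : (j : ℝ) < N := by exact_mod_cast hj
    have hx0 : 0 ≤ x := by positivity
    have hx1 : x ≤ 1 := (div_le_one (by positivity)).mpr (by linarith)
    set q : ℝ := ((k - j : ℕ) : ℝ) / ((N - j : ℕ) : ℝ)
    have hq0 : 0 ≤ q := by positivity
    have hq1 : q ≤ 1 := div_le_one_of_le₀ (by exact_mod_cast Nat.sub_le_sub_right hk j)
      (by positivity)
    have hqx : |q - x| ≤ ((j : ℝ) + 1) / (N + 1) := by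
      -- For `k < j` truncated subtraction makes `q = 0`, and the node itself is small.
      rcases lt_or_ge k j with h | h
      · have : q = 0 := by simp only [q]; rw [Nat.sub_eq_zero_of_le h.le]; simp
        rw [this, zero_sub, abs_neg, abs_of_nonneg hx0]
        have : (k : ℝ) < j := by exact_mod_cast h
        simp only [x]
        gcongr
      · have hjk : (j : ℝ) ≤ k := by exact_mod_cast h
        have hd : (0 : ℝ) < N - j := by linarith
        have e : x - q = ((j : ℝ) + 1) / (N + 1) * ((N - k) / (N - j)) := by
          simp only [x, q]
          rw [Nat.cast_sub h, Nat.cast_sub (by omega)]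
          field_simp
          ring
        have hle : ((N : ℝ) - k) / (N - j) ≤ 1 := (div_le_one hd).mpr (by linarith)
        have hge : 0 ≤ ((N : ℝ) - k) / (N - j) := div_nonneg (by linarith) hd.le
        rw [abs_sub_comm, e, abs_of_nonneg (by positivity)]
        exact mul_le_of_le_one_right (by positivity) hle
    have hr : ((k.descFactorial (j + 1) : ℕ) : ℝ) / (N.descFactorial (j + 1) : ℕ) = q * r := by
      rw [Nat.descFactorial_succ, Nat.descFactorial_succ]
      push_cast
      rw [mul_div_mul_comm]
    have hsplit : q * r - x ^ (j + 1) = q * (r - x ^ j) + x ^ j * (q - x) := by ring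
    rw [hr, hsplit]
    calc |q * (r - x ^ j) + x ^ j * (q - x)|
        ≤ q * |r - x ^ j| + x ^ j * |q - x| := by
          refine (abs_add_le _ _).trans_eq ?_
          rw [abs_mul, abs_mul, abs_of_nonneg hq0, abs_of_nonneg (pow_nonneg hx0 j)]
      _ ≤ 1 * ((j : ℝ) ^ 2 / (N + 1)) + 1 * (((j : ℝ) + 1) / (N + 1)) := by
          gcongr
          exact pow_le_one₀ hx0 hx1
      _ ≤ ((j + 1 : ℕ) : ℝ) ^ 2 / (N + 1) := by
          rw [one_mul, one_mul, ← add_div]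
          gcongr
          push_cast
          nlinarith [Nat.cast_nonneg (α := ℝ) j]

/-- The weights are the moment functional on Bernstein polynomials. They reproduce the moments
exactly with falling-factorial ratios, which are then replaced by powers of the nodes. -/
theorem CompletelyMonotone.exists_weights {f : ℝ → ℝ} (hf : CompletelyMonotone f)
    (hc : ContinuousOn f (Set.Ici 0)) {h : ℝ} (hh : 0 ≤ h) (N : ℕ) :
    ∃ w : ℕ → ℝ, (∀ k, 0 ≤ w k) ∧ ∑ k ∈ Finset.range (N + 1), w k = f 0 ∧
      ∀ j ≤ N, |∑ k ∈ Finset.range (N + 1), w k * (((k : ℝ) + 1) / (N + 1)) ^ j - f (j * h)|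
        ≤ f 0 * ((j : ℝ) ^ 2 / (N + 1)) := by
  set L := momentFunctional (fun j => f (j * h))
  have hw : ∀ k, 0 ≤ L (bernsteinPolynomial ℝ N k) := by
    intro k
    rw [bernsteinPolynomial, mul_assoc, ← map_natCast (C : ℝ →+* ℝ[X]), ← smul_eq_C_mul, map_smul]
    exact smul_nonneg (Nat.cast_nonneg _) (momentFunctional_nonneg hf hc hh _ _)
  have hmom : ∀ j ≤ N, f (j * h) = ∑ k ∈ Finset.range (N + 1),
      L (bernsteinPolynomial ℝ N k) * ((k.descFactorial j : ℝ) / N.descFactorial j) := by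
    intro j hj
    rw [← momentFunctional_X_pow (fun j => f (j * h)) j, X_pow_eq_sum_bernsteinPolynomial hj,
      map_sum]
    refine Finset.sum_congr rfl fun k _ => ?_
    rw [map_smul, smul_eq_mul, mul_comm]
  have hsum : ∑ k ∈ Finset.range (N + 1), L (bernsteinPolynomial ℝ N k) = f 0 := by
    have := hmom 0 (Nat.zero_le _)
    simpa using this.symm
  refine ⟨_, hw, hsum, fun j hj => ?_⟩
  rw [hmom j hj, ← Finset.sum_sub_distrib, ← hsum, Finset.sum_mul]
  refine (Finset.abs_sum_le_sum_abs _ _).trans (Finset.sum_le_sum fun k hk => ?_)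
  rw [← mul_sub, abs_mul, abs_of_nonneg (hw k), abs_sub_comm]
  exact mul_le_mul_of_nonneg_left
    (abs_descFactorial_div_sub_pow_le (Nat.lt_succ_iff.mp (Finset.mem_range.mp hk)) hj) (hw k)

/-- A completely monotone function that is continuous at zero is a pointwise limit of nonnegative
combinations, of fixed total weight, of decaying exponentials. -/
theorem CompletelyMonotone.exists_tendsto_sum_exp {f : ℝ → ℝ} (hf : CompletelyMonotone f)
    (hc : ContinuousOn f (Set.Ici 0)) :
    ∃ (N : ℕ → ℕ) (w r : ℕ → ℕ → ℝ), (∀ n k, 0 ≤ w n k) ∧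
      (∀ n, ∀ k ∈ Finset.range (N n + 1), 0 ≤ r n k) ∧
      (∀ n, ∑ k ∈ Finset.range (N n + 1), w n k = f 0) ∧
      ∀ t, 0 ≤ t → Tendsto
        (fun n => ∑ k ∈ Finset.range (N n + 1), w n k * Real.exp (-(r n k * t))) atTop
        (𝓝 (f t)) := by
  -- With mesh `1 / (n + 1)`, a fixed `t` has grid index `j` of order `n`; the cubic degree makes
  -- the error `j ^ 2 / N` of order `1 / n`.
  choose w hw0 hws hwm using fun n : ℕ =>
    hf.exists_weights hc (h := 1 / ((n : ℝ) + 1)) (by positivity) ((n + 1) ^ 3)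
  set N : ℕ → ℕ := fun n => (n + 1) ^ 3
  -- Chosen so that the `j`-th power of a node is the exponential at the grid point `j / (n + 1)`.
  -- The nodes are positive thanks to the `+ 1`, so the logarithm is genuine.
  set r : ℕ → ℕ → ℝ := fun n k => -(((n : ℝ) + 1) * Real.log (((k : ℝ) + 1) / (N n + 1)))
  have hr : ∀ n, ∀ k ∈ Finset.range (N n + 1), 0 ≤ r n k := by
    intro n k hk
    have hk' : (k : ℝ) ≤ N n := by exact_mod_cast Nat.lt_succ_iff.mp (Finset.mem_range.mp hk)
    refine neg_nonneg.mpr (mul_nonpos_of_nonneg_of_nonpos (by positivity) ?_)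
    exact Real.log_nonpos (by positivity) ((div_le_one (by positivity)).mpr (by linarith))
  refine ⟨N, w, r, hw0, hr, hws, fun t ht => ?_⟩
  set S : ℕ → ℝ → ℝ := fun n t => ∑ k ∈ Finset.range (N n + 1), w n k * Real.exp (-(r n k * t))
  have hanti : ∀ n s t, s ≤ t → S n t ≤ S n s := by
    intro n s t hst
    refine Finset.sum_le_sum fun k hk => mul_le_mul_of_nonneg_left ?_ (hw0 n k)
    exact Real.exp_le_exp.mpr (neg_le_neg (mul_le_mul_of_nonneg_left hst (hr n k hk)))
  have hgrid : ∀ n j : ℕ, j ≤ N n →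
      |S n (j * (1 / ((n : ℝ) + 1))) - f (j * (1 / ((n : ℝ) + 1)))| ≤
        f 0 * ((j : ℝ) ^ 2 / (N n + 1)) := by
    intro n j hj
    have := hwm n j hj
    have hN : ((((n + 1) ^ 3 : ℕ) : ℝ)) = N n := rfl
    rw [hN] at this
    refine le_trans (le_of_eq ?_) this
    congr 2
    refine Finset.sum_congr rfl fun k _ => ?_
    congr 1
    have hx : (0 : ℝ) < ((k : ℝ) + 1) / (N n + 1) := by positivity
    rw [← Real.exp_log (pow_pos hx j), Real.log_pow]
    congr 1
    simp only [r]
    field_simp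
  have hf0 : 0 ≤ f 0 := by rw [← hws 0]; exact Finset.sum_nonneg fun k _ => hw0 0 k
  have hinv : Tendsto (fun n : ℕ => 1 / ((n : ℝ) + 1)) atTop (𝓝 0) :=
    tendsto_one_div_add_atTop_nhds_zero_nat
  have hlim : ∀ j : ℕ → ℕ, (∀ n, |(j n : ℝ) * (1 / ((n : ℝ) + 1)) - t| ≤ 1 / ((n : ℝ) + 1)) →
      Tendsto (fun n => S n (j n * (1 / ((n : ℝ) + 1)))) atTop (𝓝 (f t)) := by
    intro j hj
    have hjt : Tendsto (fun n => (j n : ℝ) * (1 / ((n : ℝ) + 1))) atTop (𝓝[Set.Ici 0] t) := by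
      refine tendsto_nhdsWithin_iff.mpr ⟨?_, Eventually.of_forall fun n => Set.mem_Ici.mpr
        (by positivity)⟩
      exact tendsto_iff_norm_sub_tendsto_zero.mpr
        (squeeze_zero (fun _ => norm_nonneg _) hj hinv)
    have h1 := (hc t (Set.mem_Ici.mpr ht)).tendsto.comp hjt
    have h2 : Tendsto (fun n => S n (j n * (1 / ((n : ℝ) + 1))) - f (j n * (1 / ((n : ℝ) + 1))))
        atTop (𝓝 0) := by
      refine squeeze_zero_norm' (a := fun n : ℕ => f 0 * ((t + 1) ^ 2 * (1 / ((n : ℝ) + 1)))) ?_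
        (by simpa using (hinv.const_mul ((t + 1) ^ 2)).const_mul (f 0))
      filter_upwards [eventually_ge_atTop ⌈t + 1⌉₊] with n hn
      have hn' : t + 1 ≤ n := (Nat.le_ceil _).trans (by exact_mod_cast hn)
      have hpos : (0 : ℝ) < (n : ℝ) + 1 := by positivity
      have hjle : (j n : ℝ) ≤ (t + 1) * ((n : ℝ) + 1) := by
        have h3 := (abs_le.mp (hj n)).2
        have h4 : 1 / ((n : ℝ) + 1) ≤ 1 := by
          rw [div_le_one hpos]; linarith [Nat.cast_nonneg (α := ℝ) n]
        rw [← div_le_iff₀ hpos]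
        rw [mul_one_div] at h3
        linarith
      have hjN : j n ≤ N n := by
        have : (j n : ℝ) ≤ ((n : ℝ) + 1) ^ 3 := by
          calc (j n : ℝ) ≤ (t + 1) * ((n : ℝ) + 1) := hjle
            _ ≤ ((n : ℝ) + 1) ^ 2 * ((n : ℝ) + 1) := by gcongr; nlinarith
            _ = _ := by ring
        exact_mod_cast this
      refine (hgrid n (j n) hjN).trans ?_
      refine mul_le_mul_of_nonneg_left ?_ hf0
      calc (j n : ℝ) ^ 2 / (N n + 1) ≤ ((t + 1) * ((n : ℝ) + 1)) ^ 2 / (((n : ℝ) + 1) ^ 3) := by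
            simp only [N]
            push_cast
            gcongr
            linarith
        _ = (t + 1) ^ 2 * (1 / ((n : ℝ) + 1)) := by field_simp
    simpa using h2.add h1
  have hfl : ∀ n : ℕ, (⌊t * ((n : ℝ) + 1)⌋₊ : ℝ) ≤ t * ((n : ℝ) + 1) := fun n =>
    Nat.floor_le (by positivity)
  have hfl' : ∀ n : ℕ, t * ((n : ℝ) + 1) < ⌊t * ((n : ℝ) + 1)⌋₊ + 1 := fun n =>
    Nat.lt_floor_add_one _
  have hdiv : ∀ (n : ℕ) (x : ℝ), x * (1 / ((n : ℝ) + 1)) - t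
      = (x - t * ((n : ℝ) + 1)) * (1 / ((n : ℝ) + 1)) := by
    intro n x; field_simp
  have habs : ∀ (n : ℕ) (x : ℝ), |x - t * ((n : ℝ) + 1)| ≤ 1 →
      |x * (1 / ((n : ℝ) + 1)) - t| ≤ 1 / ((n : ℝ) + 1) := by
    intro n x hx
    rw [hdiv, abs_mul, abs_of_nonneg (show 0 ≤ 1 / ((n : ℝ) + 1) by positivity)]
    exact mul_le_of_le_one_left (by positivity) hx
  -- `S n` is antitone, so its value at `t` lies between those at the neighbouring grid points.
  refine tendsto_of_tendsto_of_tendsto_of_le_of_le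
    (hlim (fun n => ⌊t * ((n : ℝ) + 1)⌋₊ + 1) fun n => habs n _ ?_)
    (hlim (fun n => ⌊t * ((n : ℝ) + 1)⌋₊) fun n => habs n _ ?_) (fun n => ?_) (fun n => ?_)
  · rw [abs_le]; push_cast; constructor <;> linarith [hfl n, hfl' n]
  · rw [abs_le]; constructor <;> linarith [hfl n, hfl' n]
  · refine hanti n _ _ ?_
    rw [mul_one_div, le_div_iff₀ (by positivity)]
    push_cast
    exact (hfl' n).le
  · refine hanti n _ _ ?_
    rw [mul_one_div, div_le_iff₀ (by positivity)]
    exact hfl n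

end CompletelyMonotone

/-! ### Energy distances of completely monotone and linear functions -/

section EnergyCalculus

open Filter Topology

section Linearity

variable {E : Type*} [NormedAddCommGroup E] [MeasurableSpace E] {μ ν : Measure E} {f g : ℝ → ℝ}

theorem EnergyFinite.const [IsFiniteMeasure μ] [IsFiniteMeasure ν] (c : ℝ) :
    EnergyFinite (fun _ => c) μ ν :=
  ⟨integrable_const _, integrable_const _, integrable_const _⟩

theorem EnergyFinite.sub (hf : EnergyFinite f μ ν) (hg : EnergyFinite g μ ν) :
    EnergyFinite (fun t => f t - g t) μ ν :=
  ⟨hf.1.sub hg.1, hf.2.1.sub hg.2.1, hf.2.2.sub hg.2.2⟩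

theorem EnergyFinite.const_mul (hf : EnergyFinite f μ ν) (c : ℝ) :
    EnergyFinite (fun t => c * f t) μ ν :=
  ⟨hf.1.const_mul c, hf.2.1.const_mul c, hf.2.2.const_mul c⟩

theorem energyDist_sub (hf : EnergyFinite f μ ν) (hg : EnergyFinite g μ ν) :
    energyDist (fun t => f t - g t) μ ν = energyDist f μ ν - energyDist g μ ν := by
  simp only [energyDist, meanGap]
  rw [integral_sub hf.1 hg.1, integral_sub hf.2.1 hg.2.1, integral_sub hf.2.2 hg.2.2]
  ring

theorem energyDist_const_mul (c : ℝ) (f : ℝ → ℝ) (μ ν : Measure E) :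
    energyDist (fun t => c * f t) μ ν = c * energyDist f μ ν := by
  simp only [energyDist, meanGap, integral_const_mul]
  ring

theorem energyDist_sum {ι : Type*} (s : Finset ι) {F : ι → ℝ → ℝ}
    (hF : ∀ k ∈ s, EnergyFinite (F k) μ ν) :
    energyDist (fun t => ∑ k ∈ s, F k t) μ ν = ∑ k ∈ s, energyDist (F k) μ ν := by
  simp only [energyDist, meanGap]
  rw [integral_finsetSum s fun k hk => (hF k hk).1, integral_finsetSum s fun k hk => (hF k hk).2.1,
    integral_finsetSum s fun k hk => (hF k hk).2.2, Finset.sum_sub_distrib,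
    Finset.sum_sub_distrib, Finset.mul_sum]

theorem energyDist_const [IsProbabilityMeasure μ] [IsProbabilityMeasure ν] (c : ℝ) :
    energyDist (fun _ => c) μ ν = 0 := by
  simp [energyDist, meanGap]
  ring

end Linearity

theorem continuous_gap_of_continuousOn {E : Type*} [NormedAddCommGroup E] {f : ℝ → ℝ}
    (hf : ContinuousOn f (Set.Ici 0)) :
    Continuous fun p : E × E => f (‖p.1 - p.2‖ ^ 2 / 2) :=
  hf.comp_continuous (by fun_prop) fun p => Set.mem_Ici.mpr (by positivity)

theorem abs_exp_neg_mul_le_one {l t : ℝ} (hl : 0 ≤ l) (ht : 0 ≤ t) :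
    |Real.exp (-(l * t))| ≤ 1 := by
  rw [Real.abs_exp, Real.exp_le_one_iff, neg_nonpos]
  positivity

variable {E : Type*} [NormedAddCommGroup E] [InnerProductSpace ℝ E] [FiniteDimensional ℝ E]
  [MeasurableSpace E] [BorelSpace E] {μ ν : Measure E} {f g : ℝ → ℝ}

theorem EnergyFinite.mono (hg : EnergyFinite g μ ν) (hf : ContinuousOn f (Set.Ici 0))
    (hle : ∀ t, 0 ≤ t → |f t| ≤ g t) : EnergyFinite f μ ν := by
  have aux : ∀ μ ν : Measure E, MeanGapFinite g μ ν → MeanGapFinite f μ ν := fun μ ν h =>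
    Integrable.mono' h (continuous_gap_of_continuousOn hf).aestronglyMeasurable
      (ae_of_all _ fun p => hle _ (by positivity))
  exact ⟨aux _ _ hg.1, aux _ _ hg.2.1, aux _ _ hg.2.2⟩

theorem tendsto_energyDist {ι : Type*} {l : Filter ι} [l.IsCountablyGenerated] {F : ι → ℝ → ℝ}
    {b : ℝ → ℝ} (hF : ∀ᶠ n in l, ContinuousOn (F n) (Set.Ici 0)) (hb : EnergyFinite b μ ν)
    (hle : ∀ᶠ n in l, ∀ t, 0 ≤ t → |F n t| ≤ b t)
    (hlim : ∀ t, 0 ≤ t → Tendsto (fun n => F n t) l (𝓝 (f t))) :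
    Tendsto (fun n => energyDist (F n) μ ν) l (𝓝 (energyDist f μ ν)) := by
  have aux : ∀ μ ν : Measure E, MeanGapFinite b μ ν →
      Tendsto (fun n => meanGap (F n) μ ν) l (𝓝 (meanGap f μ ν)) := fun μ ν h =>
    tendsto_integral_filter_of_dominated_convergence _
      (hF.mono fun n hn => (continuous_gap_of_continuousOn hn).aestronglyMeasurable)
      (hle.mono fun n hn => ae_of_all _ fun p => hn _ (by positivity)) h
      (ae_of_all _ fun p => hlim _ (by positivity))
  exact (((aux _ _ hb.1).const_mul 2).sub (aux _ _ hb.2.1)).sub (aux _ _ hb.2.2)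

variable [IsProbabilityMeasure μ] [IsProbabilityMeasure ν]

theorem EnergyFinite.exp {l : ℝ} (hl : 0 ≤ l) :
    EnergyFinite (fun t => Real.exp (-(l * t))) μ ν :=
  (EnergyFinite.const 1).mono (by fun_prop) fun _ ht => abs_exp_neg_mul_le_one hl ht

theorem energyDist_exp_nonpos_of_nonneg {l : ℝ} (hl : 0 ≤ l) :
    energyDist (fun t => Real.exp (-(l * t))) μ ν ≤ 0 := by
  rcases hl.eq_or_lt with rfl | hl
  · simpa using (energyDist_const (μ := μ) (ν := ν) 1).le
  · exact energyDist_exp_nonpos hl μ ν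

theorem continuousOn_energyDist_exp :
    ContinuousOn (fun l => energyDist (fun t => Real.exp (-(l * t))) μ ν) (Set.Ici 0) := by
  intro l hl
  refine tendsto_energyDist (b := fun _ => 1) (Eventually.of_forall fun l => by fun_prop)
    (EnergyFinite.const 1) ?_ fun t ht => ?_
  · filter_upwards [self_mem_nhdsWithin] with l hl t ht using abs_exp_neg_mul_le_one hl ht
  · have : Continuous fun l : ℝ => Real.exp (-(l * t)) := by fun_prop
    exact this.continuousWithinAt

/-- Strict negativity for each `l` could be lost in a limit of exponential sums; this bound, uniform
in `l`, survives. The bracket can be positive only for `l` in a compact set avoiding 0, where the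
negated energy has a positive minimum. -/
theorem exists_mul_sub_le_neg_energyDist_exp (hne : μ ≠ ν) {s t η : ℝ} (hs : 0 < s)
    (hη : 0 < η) :
    ∃ κ : ℝ, 0 < κ ∧ ∀ l, 0 ≤ l → κ * (Real.exp (-(l * s)) - Real.exp (-(l * t)) - η) ≤
      -energyDist (fun t => Real.exp (-(l * t))) μ ν := by
  set e : ℝ → ℝ := fun l => energyDist (fun t => Real.exp (-(l * t))) μ ν
  have he : ∀ l, 0 ≤ l → e l ≤ 0 := fun l hl => energyDist_exp_nonpos_of_nonneg hl
  set K : Set ℝ := Set.Icc 0 (-Real.log η / s) ∩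
    (fun l => Real.exp (-(l * s)) - Real.exp (-(l * t))) ⁻¹' Set.Ici η
  have hK : IsCompact K :=
    isCompact_Icc.inter_right (isClosed_Ici.preimage (by fun_prop))
  have hout : ∀ l, 0 ≤ l → l ∉ K → Real.exp (-(l * s)) - Real.exp (-(l * t)) - η ≤ 0 := by
    intro l hl hlK
    by_contra! h
    refine hlK ⟨⟨hl, ?_⟩, sub_nonneg.mp h.le⟩
    rw [le_div_iff₀ hs, le_neg, Real.log_le_iff_le_exp hη]
    linarith [Real.exp_pos (-(l * t))]
  rcases K.eq_empty_or_nonempty with hemp | hnon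
  · refine ⟨1, one_pos, fun l hl => ?_⟩
    have h1 := hout l hl (by rw [hemp]; exact Set.notMem_empty l)
    have h2 := he l hl
    simp only [e] at h2
    linarith
  · obtain ⟨m, hm, hmin⟩ := hK.exists_isMinOn hnon
      (f := fun l => -e l) (continuousOn_energyDist_exp.neg.mono fun l hl => hl.1.1)
    have hm0 : 0 < m := by
      refine lt_of_le_of_ne hm.1.1 fun h => ?_
      have := hm.2
      rw [← h] at this
      simp only [Set.mem_preimage, zero_mul, neg_zero, sub_self, Set.mem_Ici] at this
      linarith
    have hpos : 0 < -e m := neg_pos.mpr (energyDist_exp_neg hm0 hne)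
    refine ⟨-e m, hpos, fun l hl => ?_⟩
    by_cases hlK : l ∈ K
    · refine le_trans ?_ (hmin hlK)
      refine mul_le_of_le_one_right hpos.le ?_
      have h1 : Real.exp (-(l * s)) ≤ 1 := (le_abs_self _).trans (abs_exp_neg_mul_le_one hl hs.le)
      linarith [Real.exp_pos (-(l * t))]
    · exact (mul_nonpos_of_nonneg_of_nonpos hpos.le (hout l hl hlK)).trans
        (neg_nonneg.mpr (he l hl))

theorem CompletelyMonotone.exists_tendsto_sum_energyDist_exp (hf : CompletelyMonotone f)
    (hc : ContinuousOn f (Set.Ici 0)) :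
    ∃ (N : ℕ → ℕ) (w r : ℕ → ℕ → ℝ), (∀ n k, 0 ≤ w n k) ∧
      (∀ n, ∀ k ∈ Finset.range (N n + 1), 0 ≤ r n k) ∧
      (∀ n, ∑ k ∈ Finset.range (N n + 1), w n k = f 0) ∧
      (∀ t, 0 ≤ t → Tendsto
        (fun n => ∑ k ∈ Finset.range (N n + 1), w n k * Real.exp (-(r n k * t))) atTop
        (𝓝 (f t))) ∧
      Tendsto (fun n => ∑ k ∈ Finset.range (N n + 1),
        w n k * energyDist (fun t => Real.exp (-(r n k * t))) μ ν) atTop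
        (𝓝 (energyDist f μ ν)) := by
  obtain ⟨N, w, r, hw, hr, hs, hlim⟩ := hf.exists_tendsto_sum_exp hc
  refine ⟨N, w, r, hw, hr, hs, hlim, ?_⟩
  have h1 : ∀ n, energyDist (fun t => ∑ k ∈ Finset.range (N n + 1),
      w n k * Real.exp (-(r n k * t))) μ ν = ∑ k ∈ Finset.range (N n + 1),
        w n k * energyDist (fun t => Real.exp (-(r n k * t))) μ ν := by
    intro n
    rw [energyDist_sum _ fun k hk => (EnergyFinite.exp (hr n k hk)).const_mul _]
    exact Finset.sum_congr rfl fun k _ => energyDist_const_mul _ _ _ _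
  simp_rw [← h1]
  refine tendsto_energyDist (b := fun _ => f 0) (Eventually.of_forall fun n => by fun_prop)
    (EnergyFinite.const _) (Eventually.of_forall fun n t ht => ?_) hlim
  rw [← hs n]
  refine (Finset.abs_sum_le_sum_abs _ _).trans (Finset.sum_le_sum fun k hk => ?_)
  rw [abs_mul, abs_of_nonneg (hw n k)]
  exact mul_le_of_le_one_right (hw n k) (abs_exp_neg_mul_le_one (hr n k hk) ht)

theorem CompletelyMonotone.energyDist_nonpos (hf : CompletelyMonotone f)
    (hc : ContinuousOn f (Set.Ici 0)) : energyDist f μ ν ≤ 0 := by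
  obtain ⟨N, w, r, hw, hr, -, -, hlim⟩ :=
    hf.exists_tendsto_sum_energyDist_exp (μ := μ) (ν := ν) hc
  exact le_of_tendsto' hlim fun n => Finset.sum_nonpos fun k hk =>
    mul_nonpos_of_nonneg_of_nonpos (hw n k) (energyDist_exp_nonpos_of_nonneg (hr n k hk))

/-- Average the uniform exponential bound with the approximating weights, of total mass `f 0`, and
pass to the limit. -/
theorem CompletelyMonotone.energyDist_neg (hf : CompletelyMonotone f)
    (hc : ContinuousOn f (Set.Ici 0)) (hne : μ ≠ ν) {s t : ℝ} (hs : 0 < s) (ht : 0 ≤ t)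
    (hst : f t < f s) : energyDist f μ ν < 0 := by
  obtain ⟨N, w, r, hw, hr, hsum, hf_lim, hlim⟩ :=
    hf.exists_tendsto_sum_energyDist_exp (μ := μ) (ν := ν) hc
  have hM : 0 < f 0 + 1 := by linarith [hf.nonneg_of_continuousOn hc le_rfl]
  -- Makes the loss `η * f 0` smaller than the gap `f s - f t`; the `+ 1` keeps the denominator
  -- visibly positive.
  set η := (f s - f t) / (2 * (f 0 + 1)) with hη
  have hd : 0 < f s - f t := by linarith
  obtain ⟨κ, hκ, hle⟩ := exists_mul_sub_le_neg_energyDist_exp (t := t) hne hs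
    (show 0 < η by positivity)
  have h1 : ∀ n, κ * (∑ k ∈ Finset.range (N n + 1), w n k * Real.exp (-(r n k * s))
      - ∑ k ∈ Finset.range (N n + 1), w n k * Real.exp (-(r n k * t)) - η * f 0) ≤
      -∑ k ∈ Finset.range (N n + 1),
        w n k * energyDist (fun t => Real.exp (-(r n k * t))) μ ν := by
    intro n
    rw [← hsum n, ← Finset.sum_sub_distrib, Finset.mul_sum, ← Finset.sum_sub_distrib,
      Finset.mul_sum, ← Finset.sum_neg_distrib]
    refine Finset.sum_le_sum fun k hk => ?_
    have := mul_le_mul_of_nonneg_left (hle _ (hr n k hk)) (hw n k)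
    linarith
  have h2 := le_of_tendsto_of_tendsto' ((((hf_lim s hs.le).sub (hf_lim t ht)).sub_const
    (η * f 0)).const_mul κ) hlim.neg h1
  have h3 : η * f 0 < f s - f t := by
    have : η * (f 0 + 1) = (f s - f t) / 2 := by rw [hη]; field_simp
    have hη0 : 0 < η := by positivity
    nlinarith
  have h4 : 0 < κ * (f s - f t - η * f 0) := mul_pos hκ (by linarith)
  linarith

/-- The linear function is the limit of `c * (1 - exp (-(l * t))) / l` as `l` tends to 0, dominated
by `c * t` itself. -/
theorem energyDist_const_mul_id_nonneg {c : ℝ} (hc : 0 ≤ c)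
    (hfin : EnergyFinite (fun t => c * t) μ ν) : 0 ≤ energyDist (fun t => c * t) μ ν := by
  have hlim : Tendsto (fun n : ℕ => energyDist
      (fun t => c * (((n : ℝ) + 1) * (1 - Real.exp (-(1 / ((n : ℝ) + 1) * t))))) μ ν) atTop
      (𝓝 (energyDist (fun t => c * t) μ ν)) := by
    refine tendsto_energyDist (Eventually.of_forall fun n => by fun_prop) hfin
      (Eventually.of_forall fun n t ht => ?_) fun t ht => ?_
    · have hx : 0 ≤ 1 / ((n : ℝ) + 1) * t := by positivity
      have h1 : 0 ≤ 1 - Real.exp (-(1 / ((n : ℝ) + 1) * t)) := by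
        rw [sub_nonneg, Real.exp_le_one_iff]; linarith
      have h2 : 1 - Real.exp (-(1 / ((n : ℝ) + 1) * t)) ≤ 1 / ((n : ℝ) + 1) * t := by
        linarith [Real.add_one_le_exp (-(1 / ((n : ℝ) + 1) * t))]
      rw [abs_of_nonneg (by positivity)]
      refine mul_le_mul_of_nonneg_left ?_ hc
      calc ((n : ℝ) + 1) * (1 - Real.exp (-(1 / ((n : ℝ) + 1) * t)))
          ≤ ((n : ℝ) + 1) * (1 / ((n : ℝ) + 1) * t) := by gcongr
        _ = t := by field_simp
    · refine Tendsto.const_mul c ?_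
      have hd : HasDerivAt (fun l : ℝ => 1 - Real.exp (-(l * t))) t 0 := by
        have := (((hasDerivAt_id (0 : ℝ)).mul_const t).neg.exp).const_sub 1
        simpa using this
      have h0 : Tendsto (fun n : ℕ => 1 / ((n : ℝ) + 1)) atTop (𝓝[≠] 0) :=
        tendsto_nhdsWithin_iff.mpr ⟨tendsto_one_div_add_atTop_nhds_zero_nat,
          Eventually.of_forall fun n => by
            simp only [Set.mem_compl_iff, Set.mem_singleton_iff]; positivity⟩
      have := hd.tendsto_slope_zero.comp h0
      simpa [Function.comp_def] using this
  refine ge_of_tendsto' hlim fun n => ?_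
  have hl : 0 ≤ 1 / ((n : ℝ) + 1) := by positivity
  rw [energyDist_const_mul, energyDist_const_mul,
    energyDist_sub (EnergyFinite.const 1) (EnergyFinite.exp hl), energyDist_const]
  have := energyDist_exp_nonpos_of_nonneg (μ := μ) (ν := ν) hl
  refine mul_nonneg hc (mul_nonneg (by positivity) (by linarith))

end EnergyCalculus

/-! ### Positivity of the energy distance -/

section EnergyGenerator

open Filter Topology

variable {γ : ℝ → ℝ}

theorem IsEnergyGenerator.continuousOn_comp_add (hγ : IsEnergyGenerator γ) {a : ℝ} (ha : 0 ≤ a) :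
    ContinuousOn (fun t => γ (t + a)) (Set.Ici 0) :=
  hγ.continuousOn.comp (by fun_prop) fun _ ht => add_nonneg (Set.mem_Ici.mp ht) ha

theorem IsEnergyGenerator.differentiableAt (hγ : IsEnergyGenerator γ) {t : ℝ} (ht : 0 < t) :
    DifferentiableAt ℝ γ t :=
  hγ.differentiableOn.differentiableAt (Ioi_mem_nhds ht)

theorem IsEnergyGenerator.deriv_increment (hγ : IsEnergyGenerator γ) {a b : ℝ} (ha : 0 ≤ a)
    (hb : 0 ≤ b) {t : ℝ} (ht : 0 < t) :
    HasDerivAt (fun t => γ (t + b) - γ (t + a)) (deriv γ (t + b) - deriv γ (t + a)) t := by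
  have h : ∀ a, 0 ≤ a → HasDerivAt (fun t => γ (t + a)) (deriv γ (t + a)) t := fun a ha =>
    (hγ.differentiableAt (by linarith)).hasDerivAt.comp_add_const t a
  exact (h b hb).sub (h a ha)

/-- The negated derivative is a backward difference of `deriv γ`. Thus increments of `γ`, unlike `γ`
itself, fall under the exponential approximation. -/
theorem IsEnergyGenerator.completelyMonotone_increment (hγ : IsEnergyGenerator γ) {a b : ℝ}
    (ha : 0 ≤ a) (hab : a ≤ b) : CompletelyMonotone (fun t => γ (t + b) - γ (t + a)) := by
  have hd := fun (t : ℝ) (ht : 0 < t) => hγ.deriv_increment ha (ha.trans hab) ht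
  refine CompletelyMonotone.of_neg_deriv
    (fun t ht => (hd t ht).differentiableAt.differentiableWithinAt) (fun t ht => ?_) ?_
  · exact sub_nonneg.mpr (hγ.monotoneOn (Set.mem_Ici.mpr (by linarith))
      (Set.mem_Ici.mpr (by linarith)) (by linarith))
  · refine ((hγ.completelyMonotone_deriv.sub_comp_add (sub_nonneg.mpr hab)).comp_add ha).congr
      fun t ht => ?_
    simp only [(hd t ht).deriv]
    rw [add_assoc, add_sub_cancel]
    ring

theorem IsEnergyGenerator.continuousOn_increment (hγ : IsEnergyGenerator γ) {a b : ℝ}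
    (ha : 0 ≤ a) (hab : a ≤ b) :
    ContinuousOn (fun t => γ (t + b) - γ (t + a)) (Set.Ici 0) :=
  (hγ.continuousOn_comp_add (ha.trans hab)).sub (hγ.continuousOn_comp_add ha)

/-- Subadditivity, from comparing an antitone increment at 0 and at `t`; it makes `γ` a dominating
function for all shifted copies. -/
theorem IsEnergyGenerator.add_sub_le (hγ : IsEnergyGenerator γ) {a t : ℝ} (ha : 0 ≤ a)
    (ht : 0 ≤ t) : γ (t + a) - γ a ≤ γ t := by
  have := (hγ.completelyMonotone_increment le_rfl ha).antitoneOn_Ici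
    (hγ.continuousOn_increment le_rfl ha) (Set.mem_Ici.mpr le_rfl) (Set.mem_Ici.mpr ht) ht
  simp only [add_zero, zero_add, hγ.map_zero] at this
  linarith

/-- Otherwise `deriv γ` would be 1-periodic and antitone, hence constant. -/
theorem IsEnergyGenerator.exists_increment_lt (hγ : IsEnergyGenerator γ) :
    ∃ s t : ℝ, 0 < s ∧ 0 < t ∧ γ (t + 1) - γ (t + 0) < γ (s + 1) - γ (s + 0) := by
  by_contra! h
  have hper : ∀ t, 0 < t → deriv γ (t + 1) = deriv γ t := by
    intro t ht
    have h1 := hγ.deriv_increment le_rfl zero_le_one ht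
    have h2 : (fun t => γ (t + 1) - γ (t + 0)) =ᶠ[𝓝 t] fun _ => γ (t + 1) - γ (t + 0) := by
      filter_upwards [Ioi_mem_nhds ht] with s hs
      exact le_antisymm (h s t hs ht) (h t s ht hs)
    have := (h1.congr_of_eventuallyEq h2.symm).unique (hasDerivAt_const t _)
    simpa [sub_eq_zero] using this
  have hper' : ∀ (n : ℕ) (t : ℝ), 0 < t → deriv γ (t + n) = deriv γ t := by
    intro n
    induction n with
    | zero => simp
    | succ n ih =>
      intro t ht
      rw [Nat.cast_succ, ← add_assoc, hper _ (by positivity), ih t ht]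
  have hle : ∀ s t, 0 < s → 0 < t → deriv γ t ≤ deriv γ s := by
    intro s t hs ht
    obtain ⟨n, hn⟩ := exists_nat_ge s
    rw [← hper' n t ht]
    exact hγ.completelyMonotone_deriv.antitoneOn (Set.mem_Ioi.mpr hs)
      (Set.mem_Ioi.mpr (by positivity)) (by linarith)
  exact hγ.deriv_nonconstant ⟨deriv γ 1, fun t ht =>
    le_antisymm (hle 1 t one_pos ht) (hle t 1 ht one_pos)⟩

/-- The slope `c` is the limit of `deriv γ` at infinity; the mean value theorem squeezes the
increment. -/
theorem IsEnergyGenerator.exists_tendsto_increment (hγ : IsEnergyGenerator γ) :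
    ∃ c : ℝ, 0 ≤ c ∧ ∀ t, 0 ≤ t →
      Tendsto (fun n : ℕ => γ (t + (n + 1)) - γ (n + 1)) atTop (𝓝 (c * t)) := by
  have hanti : Antitone fun n : ℕ => deriv γ ((n : ℝ) + 1) := fun m n hmn =>
    hγ.completelyMonotone_deriv.antitoneOn (Set.mem_Ioi.mpr (by positivity))
      (Set.mem_Ioi.mpr (by positivity)) (by gcongr)
  have hnn : ∀ n : ℕ, 0 ≤ deriv γ ((n : ℝ) + 1) := fun n =>
    hγ.completelyMonotone_deriv.nonneg (by positivity)
  have hbdd : BddBelow (Set.range fun n : ℕ => deriv γ ((n : ℝ) + 1)) :=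
    ⟨0, by rintro _ ⟨n, rfl⟩; exact hnn n⟩
  have hlim := tendsto_atTop_ciInf hanti hbdd
  set c := ⨅ n : ℕ, deriv γ ((n : ℝ) + 1)
  have hc : ∀ x, 0 < x → c ≤ deriv γ x := by
    intro x hx
    obtain ⟨n, hn⟩ := exists_nat_ge x
    exact (ciInf_le hbdd n).trans (hγ.completelyMonotone_deriv.antitoneOn (Set.mem_Ioi.mpr hx)
      (Set.mem_Ioi.mpr (by positivity)) (by linarith))
  refine ⟨c, le_ciInf hnn, fun t ht => ?_⟩
  rcases ht.eq_or_lt with rfl | ht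
  · simp
  have hmvt : ∀ n : ℕ, ∃ x, (n : ℝ) + 1 < x ∧ γ (t + (n + 1)) - γ (n + 1) = deriv γ x * t := by
    intro n
    have hn : (0 : ℝ) ≤ n := n.cast_nonneg
    obtain ⟨x, hx, hxe⟩ := exists_deriv_eq_slope γ (show (n : ℝ) + 1 < t + (n + 1) by linarith)
      (hγ.continuousOn.mono fun x hx => Set.mem_Ici.mpr (by linarith [hx.1]))
      (hγ.differentiableOn.mono fun x hx => Set.mem_Ioi.mpr (by linarith [hx.1]))
    refine ⟨x, hx.1, ?_⟩
    rw [hxe, add_sub_cancel_right, div_mul_cancel₀ _ ht.ne']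
  refine tendsto_of_tendsto_of_tendsto_of_le_of_le tendsto_const_nhds (hlim.mul_const t)
    (fun n => ?_) (fun n => ?_)
  all_goals
    obtain ⟨x, hx, hxe⟩ := hmvt n
    have hn : (0 : ℝ) ≤ n := n.cast_nonneg
    simp only [hxe]
    refine mul_le_mul_of_nonneg_right ?_ ht.le
  · exact hc x (by linarith)
  · exact hγ.completelyMonotone_deriv.antitoneOn (Set.mem_Ioi.mpr (by linarith))
      (Set.mem_Ioi.mpr (by linarith)) hx.le

/-- The energy distance of two different distributions is positive. -/
theorem IsEnergyGenerator.energyDist_pos (hγ : IsEnergyGenerator γ) {E : Type*}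
    [NormedAddCommGroup E] [InnerProductSpace ℝ E] [FiniteDimensional ℝ E] [MeasurableSpace E]
    [BorelSpace E] {μ ν : Measure E} [IsProbabilityMeasure μ] [IsProbabilityMeasure ν]
    (hfin : EnergyFinite γ μ ν) (hne : μ ≠ ν) : 0 < energyDist γ μ ν := by
  obtain ⟨c, hc0, hc⟩ := hγ.exists_tendsto_increment
  have habs : ∀ (n : ℕ) (t : ℝ), 0 ≤ t → |γ (t + (n + 1)) - γ (n + 1)| ≤ γ t := by
    intro n t ht
    rw [abs_of_nonneg (sub_nonneg.mpr (hγ.monotoneOn (Set.mem_Ici.mpr (by positivity))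
      (Set.mem_Ici.mpr (by positivity)) (by linarith)))]
    exact hγ.add_sub_le (by positivity) ht
  have hcont : ∀ n : ℕ, ContinuousOn (fun t => γ (t + (n + 1)) - γ (n + 1)) (Set.Ici 0) :=
    fun n => (hγ.continuousOn_comp_add (by positivity)).sub continuousOn_const
  have hlin : 0 ≤ energyDist (fun t => c * t) μ ν := by
    refine energyDist_const_mul_id_nonneg hc0 (hfin.mono (by fun_prop) fun t ht => ?_)
    exact le_of_tendsto' (hc t ht).abs fun n => habs n t ht
  have hlim : Tendsto (fun n : ℕ => energyDist (fun t => γ (t + (n + 1)) - γ (n + 1)) μ ν) atTop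
      (𝓝 (energyDist (fun t => c * t) μ ν)) :=
    tendsto_energyDist (Eventually.of_forall hcont) hfin (Eventually.of_forall habs) hc
  have hincr : ∀ a b : ℝ, 0 ≤ a → a ≤ b → EnergyFinite (fun t => γ (t + b) - γ (t + a)) μ ν := by
    intro a b ha hab
    refine (EnergyFinite.const (γ (0 + b) - γ (0 + a))).mono
      (hγ.continuousOn_increment ha hab) fun t ht => ?_
    have hcm := hγ.completelyMonotone_increment ha hab
    have hcn := hγ.continuousOn_increment ha hab
    rw [abs_of_nonneg (hcm.nonneg_of_continuousOn hcn ht)]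
    exact hcm.antitoneOn_Ici hcn (Set.mem_Ici.mpr le_rfl) (Set.mem_Ici.mpr ht) ht
  obtain ⟨s, t, hs, ht, hst⟩ := hγ.exists_increment_lt
  have hone : energyDist (fun t => γ (t + 1) - γ (t + 0)) μ ν < 0 :=
    (hγ.completelyMonotone_increment le_rfl zero_le_one).energyDist_neg
      (hγ.continuousOn_increment le_rfl zero_le_one) hne hs ht.le hst
  have hbound : ∀ n : ℕ, energyDist (fun t => γ (t + (n + 1)) - γ (n + 1)) μ ν ≤
      energyDist γ μ ν + energyDist (fun t => γ (t + 1) - γ (t + 0)) μ ν := by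
    intro n
    have h1n : (1 : ℝ) ≤ (n : ℝ) + 1 := by linarith [n.cast_nonneg (α := ℝ)]
    have hnp : energyDist (fun t => γ (t + ((n : ℝ) + 1)) - γ (t + 1)) μ ν ≤ 0 :=
      (hγ.completelyMonotone_increment zero_le_one h1n).energyDist_nonpos
        (hγ.continuousOn_increment zero_le_one h1n)
    have hf1 := hincr 1 ((n : ℝ) + 1) zero_le_one h1n
    have hf0 := hincr 0 1 le_rfl zero_le_one
    have hfn : EnergyFinite (fun t => γ (t + ((n : ℝ) + 1)) - γ ((n : ℝ) + 1)) μ ν :=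
      hfin.mono (hcont n) (habs n)
    -- Every bracket has finite energy: the shifted copy is dominated by `γ`, and the increments are
    -- bounded.
    have hdecomp : γ = fun t => ((γ (t + ((n : ℝ) + 1)) - γ ((n : ℝ) + 1)) -
        (γ (t + 1) - γ (t + 0))) - ((γ (t + ((n : ℝ) + 1)) - γ (t + 1)) - γ ((n : ℝ) + 1)) := by
      funext t
      rw [add_zero]
      ring
    have heq : energyDist γ μ ν =
        energyDist (fun t => γ (t + ((n : ℝ) + 1)) - γ ((n : ℝ) + 1)) μ ν -
        energyDist (fun t => γ (t + 1) - γ (t + 0)) μ ν -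
        energyDist (fun t => γ (t + ((n : ℝ) + 1)) - γ (t + 1)) μ ν := by
      conv_lhs => rw [hdecomp]
      rw [energyDist_sub (hfn.sub hf0) (hf1.sub (EnergyFinite.const _)), energyDist_sub hfn hf0,
        energyDist_sub hf1 (EnergyFinite.const _), energyDist_const]
      ring
    linarith
  have := le_of_tendsto' hlim hbound
  linarith

end EnergyGenerator

/-! ### Joint laws of pairs and extension to perfect pairings -/

section Pairings

variable {d : ℕ}

theorem measurable_subvector (p : Finset (Fin d)) : Measurable (subvector p) :=
  (MeasurableEquiv.toLp 2 _).measurable.comp (by fun_prop)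

/-- The joint law of two independent coordinates is determined by the marginal laws. -/
theorem jointLaw_pair_eq_of_indepFun {F G : Measure (Fin d → ℝ)} [IsProbabilityMeasure F]
    [IsProbabilityMeasure G] {a b : Fin d} (ha : marginalLaw F a = marginalLaw G a)
    (hb : marginalLaw F b = marginalLaw G b)
    (hF : IndepFun (fun x : Fin d → ℝ => x a) (fun x => x b) F)
    (hG : IndepFun (fun x : Fin d → ℝ => x a) (fun x => x b) G) :
    jointLaw F {a, b} = jointLaw G {a, b} := by
  let Φ : ℝ × ℝ → EuclideanSpace ℝ ({a, b} : Finset (Fin d)) := fun u =>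
    WithLp.toLp 2 fun k => if (k : Fin d) = a then u.1 else u.2
  have hΦ : Measurable Φ := by
    refine (MeasurableEquiv.toLp 2 _).measurable.comp (measurable_pi_lambda _ fun k => ?_)
    split_ifs
    · exact measurable_fst
    · exact measurable_snd
  have hsub : subvector ({a, b} : Finset (Fin d)) = Φ ∘ fun x => (x a, x b) := by
    funext x
    simp only [subvector, Φ, Function.comp]
    congr 1
    funext k
    rcases k with ⟨k, hk⟩
    rcases Finset.mem_insert.mp hk with rfl | hk
    · simp
    · rw [Finset.mem_singleton] at hk
      subst hk
      simp only
      split_ifs with h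
      · rw [h]
      · rfl
  have hpair : Measurable fun x : Fin d → ℝ => (x a, x b) := by fun_prop
  rw [jointLaw, jointLaw, hsub, ← Measure.map_map hΦ hpair, ← Measure.map_map hΦ hpair,
    (indepFun_iff_map_prod_eq_prod_map_map (measurable_pi_apply a).aemeasurable
      (measurable_pi_apply b).aemeasurable).mp hF,
    (indepFun_iff_map_prod_eq_prod_map_map (measurable_pi_apply a).aemeasurable
      (measurable_pi_apply b).aemeasurable).mp hG]
  simp only [marginalLaw] at ha hb
  rw [ha, hb]

theorem coordinate_eq_comp_subvector {p : Finset (Fin d)} {a : Fin d} (ha : a ∈ p) :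
    (fun x : Fin d → ℝ => x a) = (fun y : EuclideanSpace ℝ p => y ⟨a, ha⟩) ∘ subvector p := rfl

/-- Each coordinate inherits independence from a signal pair containing it. Two signal coordinates
lie in different pairs, since a common pair would equal `{a, b}` by cardinality. -/
theorem SignalIndependence.indepFun_coordinates {s : ℕ} {i j : Fin s → Fin d}
    {H : Measure (Fin d → ℝ)} (hH : SignalIndependence i j H) {a b : Fin d} (hab : a ≠ b)
    (hcard : ∀ p ∈ signalPairs i j, p.card = 2) (hp : {a, b} ∉ signalPairs i j)
    (hn : a ∉ noiseCoords i j ∨ b ∉ noiseCoords i j) :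
    IndepFun (fun x : Fin d → ℝ => x a) (fun x => x b) H := by
  have hmem : ∀ c, c ∉ noiseCoords i j → ∃ p ∈ signalPairs i j, c ∈ p := by
    intro c hc
    simp only [noiseCoords, Set.mem_compl_iff, not_not] at hc
    rcases hc with ⟨k, rfl⟩ | ⟨k, rfl⟩ <;>
      exact ⟨{i k, j k}, Finset.mem_image_of_mem _ (Finset.mem_univ k), by simp⟩
  have hmeas : ∀ (p : Finset (Fin d)) (c : p), Measurable fun y : EuclideanSpace ℝ p => y c :=
    fun p c => by fun_prop
  by_cases ha : a ∈ noiseCoords i j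
  · obtain ⟨q, hq, hbq⟩ := hmem b (hn.resolve_left (not_not.mpr ha))
    rw [coordinate_eq_comp_subvector hbq]
    exact ((hH.signal_noise q hq a ha).comp (hmeas q ⟨b, hbq⟩) measurable_id).symm
  · obtain ⟨p, hp', hap⟩ := hmem a ha
    by_cases hb : b ∈ noiseCoords i j
    · rw [coordinate_eq_comp_subvector hap]
      exact (hH.signal_noise p hp' b hb).comp (hmeas p ⟨a, hap⟩) measurable_id
    · obtain ⟨q, hq, hbq⟩ := hmem b hb
      have hpq : p ≠ q := by
        rintro rfl
        refine hp ?_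
        have : ({a, b} : Finset (Fin d)) = p := Finset.eq_of_subset_of_card_le
          (by intro c hc; rcases Finset.mem_insert.mp hc with rfl | hc
              · exact hap
              · rw [Finset.mem_singleton.mp hc]; exact hbq)
          (by rw [hcard p hp', Finset.card_pair hab])
        rwa [this]
      rw [coordinate_eq_comp_subvector hap, coordinate_eq_comp_subvector hbq]
      exact (hH.signal_signal p hp' q hq hpq).comp (hmeas p ⟨a, hap⟩) (hmeas q ⟨b, hbq⟩)

theorem energyDist_self {E : Type*} [NormedAddCommGroup E] [MeasurableSpace E] (γ : ℝ → ℝ)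
    (μ : Measure E) : energyDist γ μ μ = 0 := by
  rw [energyDist]; ring

theorem card_of_mem_signalPairs {s : ℕ} {i j : Fin s → Fin d}
    (hinj : Function.Injective (Sum.elim i j)) : ∀ p ∈ signalPairs i j, p.card = 2 := by
  intro p hp
  obtain ⟨k, -, rfl⟩ := Finset.mem_image.mp hp
  refine Finset.card_pair fun h => ?_
  exact Sum.inl_ne_inr (hinj (a₁ := Sum.inl k) (a₂ := Sum.inr k) h)

theorem disjoint_signalPair {s : ℕ} {i j : Fin s → Fin d}
    (hinj : Function.Injective (Sum.elim i j)) {k l : Fin s} (hkl : k ≠ l) :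
    Disjoint ({i k, j k} : Finset (Fin d)) {i l, j l} := by
  have h1 : i k ≠ i l := fun h => hkl (Sum.inl_injective (hinj (a₁ := .inl k) (a₂ := .inl l) h))
  have h2 : j k ≠ j l := fun h => hkl (Sum.inr_injective (hinj (a₁ := .inr k) (a₂ := .inr l) h))
  have h3 : ∀ k l, i k ≠ j l := fun k l h =>
    Sum.inl_ne_inr (hinj (a₁ := .inl k) (a₂ := .inr l) h)
  rw [Finset.disjoint_left]
  intro c hc hc'
  simp only [Finset.mem_insert, Finset.mem_singleton] at hc hc'
  rcases hc with rfl | rfl <;> rcases hc' with h | h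
  · exact h1 h
  · exact h3 _ _ h
  · exact h3 _ _ h.symm
  · exact h2 h

theorem pairEnergy_eq_zero_of_notMem {s : ℕ} {γ : ℝ → ℝ} {F G : Measure (Fin d → ℝ)}
    [IsProbabilityMeasure F] [IsProbabilityMeasure G] {i j : Fin s → Fin d}
    (hset : PairedSignalSetting i j F G) (hF : SignalIndependence i j F)
    (hG : SignalIndependence i j G) {p : Finset (Fin d)} (hcard : p.card = 2)
    (hp : p ∉ signalPairs i j) : pairEnergy γ F G p = 0 := by
  obtain ⟨a, b, hab, rfl⟩ := Finset.card_eq_two.mp hcard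
  have hS := card_of_mem_signalPairs hset.distinct
  have : jointLaw F {a, b} = jointLaw G {a, b} := by
    by_cases hn : a ∉ noiseCoords i j ∨ b ∉ noiseCoords i j
    · exact jointLaw_pair_eq_of_indepFun (hset.marginal_eq a) (hset.marginal_eq b)
        (hF.indepFun_coordinates hab hS hp hn) (hG.indepFun_coordinates hab hS hp hn)
    · push Not at hn
      exact hset.noise_eq a hn.1 b hn.2 hab
  rw [pairEnergy, this, energyDist_self]

theorem exists_finpartition_card_two {α : Type*} [DecidableEq α] (A : Finset α)
    (hA : Even A.card) : ∃ P : Finpartition A, ∀ p ∈ P.parts, p.card = 2 := by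
  induction A using Finset.strongInduction with
  | H A ih =>
    rcases A.eq_empty_or_nonempty with rfl | hne
    · exact ⟨Finpartition.empty _, by simp⟩
    · have h1 := hne.card_pos
      obtain ⟨B, hBA, hB⟩ := Finset.exists_subset_card_eq (s := A) (n := 2) (by
        obtain ⟨r, hr⟩ := hA; omega)
      have hBne : B.Nonempty := Finset.card_pos.mp (by omega)
      obtain ⟨P, hP⟩ := ih (A \ B) (Finset.sdiff_ssubset hBA hBne) (by
        rw [Finset.card_sdiff_of_subset hBA, hB]
        obtain ⟨r, hr⟩ := hA
        exact ⟨r - 1, by omega⟩)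
      refine ⟨P.extend (b := B) (by simpa using hBne.ne_empty) Finset.sdiff_disjoint
        (Finset.sdiff_union_of_subset hBA), fun p hp => ?_⟩
      rw [Finpartition.extend_parts, Finset.mem_insert] at hp
      rcases hp with rfl | hp
      · exact hB
      · exact hP p hp

/-- A family of disjoint pairs in a finite set of even cardinality extends to a partition into
pairs. -/
theorem exists_finpartition_card_two_superset {α : Type*} [DecidableEq α] (A : Finset α)
    (hA : Even A.card) (S : Finset (Finset α)) (hS : ∀ p ∈ S, p ⊆ A)
    (hcard : ∀ p ∈ S, p.card = 2) (hdisj : (S : Set (Finset α)).PairwiseDisjoint id) :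
    ∃ P : Finpartition A, (∀ p ∈ P.parts, p.card = 2) ∧ S ⊆ P.parts := by
  induction S using Finset.induction_on generalizing A with
  | empty =>
    obtain ⟨P, hP⟩ := exists_finpartition_card_two A hA
    exact ⟨P, hP, Finset.empty_subset _⟩
  | insert B S hBS ih =>
    have hB := hcard B (Finset.mem_insert_self _ _)
    have hBA := hS B (Finset.mem_insert_self _ _)
    have hBne : B.Nonempty := Finset.card_pos.mp (by omega)
    obtain ⟨P, hP, hSP⟩ := ih (A \ B) (by
        rw [Finset.card_sdiff_of_subset hBA, hB]
        have := Finset.card_le_card hBA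
        obtain ⟨r, hr⟩ := hA
        exact ⟨r - 1, by omega⟩)
      (fun p hp => Finset.subset_sdiff.mpr ⟨hS p (Finset.mem_insert_of_mem hp),
        hdisj (by simp [hp]) (by simp) (by rintro rfl; exact hBS hp)⟩)
      (fun p hp => hcard p (Finset.mem_insert_of_mem hp))
      (hdisj.subset (by simp))
    refine ⟨P.extend (b := B) (by simpa using hBne.ne_empty) Finset.sdiff_disjoint
        (Finset.sdiff_union_of_subset hBA), fun p hp => ?_, ?_⟩
    · rw [Finpartition.extend_parts, Finset.mem_insert] at hp
      rcases hp with rfl | hp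
      · exact hB
      · exact hP p hp
    · rw [Finpartition.extend_parts]
      exact Finset.insert_subset_insert _ hSP

theorem exists_perfectPairing_signalPairs_subset {s : ℕ} (hd : Even d) {i j : Fin s → Fin d}
    (hinj : Function.Injective (Sum.elim i j)) :
    ∃ P : PerfectPairing d, signalPairs i j ⊆ P.pairs := by
  obtain ⟨P, hP, hSP⟩ := exists_finpartition_card_two_superset Finset.univ (by simpa using hd)
    (signalPairs i j) (fun p _ => Finset.subset_univ p) (card_of_mem_signalPairs hinj) (by
      intro p hp q hq hpq
      obtain ⟨k, -, rfl⟩ := Finset.mem_image.mp (Finset.mem_coe.mp hp)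
      obtain ⟨l, -, rfl⟩ := Finset.mem_image.mp (Finset.mem_coe.mp hq)
      exact disjoint_signalPair hinj (by rintro rfl; exact hpq rfl))
  exact ⟨⟨P, hP⟩, hSP⟩

end Pairings

/-! ### The maximal total energy -/

theorem mainTheorem5 {d s : ℕ} (hd : Even d)
    (γ : ℝ → ℝ) (hγ : IsEnergyGenerator γ)
    (F G : Measure (Fin d → ℝ)) [IsProbabilityMeasure F] [IsProbabilityMeasure G]
    (hfin : ∀ p : Finset (Fin d), p.card = 2 → EnergyFinite γ (jointLaw F p) (jointLaw G p))
    (i j : Fin s → Fin d)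
    (hset : PairedSignalSetting i j F G)
    (hF : SignalIndependence i j F) (hG : SignalIndependence i j G) :
    IsGreatest (Set.range (totalEnergy γ F G)) (∑ p ∈ signalPairs i j, pairEnergy γ F G p) ∧
      ∑ p ∈ signalPairs i j, pairEnergy γ F G p =
        ∑ k : Fin s, pairEnergy γ F G {i k, j k} ∧
      ∀ P : PerfectPairing d,
        IsMaxOn (totalEnergy γ F G) Set.univ P ↔ signalPairs i j ⊆ P.pairs := by
  have hcard := card_of_mem_signalPairs hset.distinct
  have hpos : ∀ p ∈ signalPairs i j, 0 < pairEnergy γ F G p := by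
    intro p hp
    have : IsProbabilityMeasure (jointLaw F p) :=
      Measure.isProbabilityMeasure_map (measurable_subvector p).aemeasurable
    have : IsProbabilityMeasure (jointLaw G p) :=
      Measure.isProbabilityMeasure_map (measurable_subvector p).aemeasurable
    exact hγ.energyDist_pos (hfin p (hcard p hp)) (hset.signal_ne p hp)
  have htotal : ∀ P : PerfectPairing d, totalEnergy γ F G P =
      ∑ p ∈ signalPairs i j with p ∈ P.pairs, pairEnergy γ F G p := by
    intro P
    have h1 : (signalPairs i j).filter (· ∈ P.pairs) ⊆ P.pairs := fun p hp =>
      (Finset.mem_filter.mp hp).2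
    refine (Finset.sum_subset h1 fun p hp hp' => ?_).symm
    exact pairEnergy_eq_zero_of_notMem hset hF hG (P.2 p hp) fun h =>
      hp' (Finset.mem_filter.mpr ⟨h, hp⟩)
  have hle : ∀ P : PerfectPairing d, totalEnergy γ F G P ≤
      ∑ p ∈ signalPairs i j, pairEnergy γ F G p := by
    intro P
    rw [htotal P]
    exact Finset.sum_le_sum_of_subset_of_nonneg (Finset.filter_subset _ _)
      fun p hp _ => (hpos p hp).le
  have heq : ∀ P : PerfectPairing d, totalEnergy γ F G P =
      ∑ p ∈ signalPairs i j, pairEnergy γ F G p ↔ signalPairs i j ⊆ P.pairs := by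
    intro P
    refine ⟨fun h p hp => ?_, fun h => ?_⟩
    · by_contra hpP
      refine absurd h (ne_of_lt ?_)
      rw [htotal P]
      exact Finset.sum_lt_sum_of_subset (Finset.filter_subset _ _) hp
        (fun hp' => hpP (Finset.mem_filter.mp hp').2) (hpos p hp) fun q hq _ => (hpos q hq).le
    · rw [htotal P, Finset.filter_true_of_mem h]
  obtain ⟨P₀, hP₀⟩ := exists_perfectPairing_signalPairs_subset hd hset.distinct
  refine ⟨⟨⟨P₀, (heq P₀).mpr hP₀⟩, ?_⟩, ?_, fun P => ?_⟩
  · rintro _ ⟨P, rfl⟩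
    exact hle P
  -- Different indices give disjoint nonempty pairs, so passing to the set of pairs merges no terms.
  · refine Finset.sum_image fun k _ l _ hkl => ?_
    by_contra hne
    have := disjoint_signalPair hset.distinct hne
    rw [hkl, disjoint_self] at this
    exact Finset.insert_ne_empty _ _ this
  · rw [← heq P]
    refine ⟨fun h => le_antisymm (hle P) ?_, fun h Q _ => ?_⟩
    -- A maximiser must do at least as well as `P₀`, which attains the full signal sum.
    · rw [← (heq P₀).mpr hP₀]
      exact h (Set.mem_univ P₀)
    · exact (hle Q).trans_eq h.symm
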